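/- Let $N\ge 1$, $0<\lambda\le\Lambda$, and let $\mathrm{Sym}_N$ be the space of real symmetric $N\times N$ matrices. For $M\in\mathrm{Sym}_N$ let \[ \mathcal M^+_{\lambda,\Lambda}(M)=\sup_{\lambda I_N\le A\le\Lambda I_N}-\mathrm{Tr}(AM),\qquad \mathcal M^-_{\lambda,\Lambda}(M)=\inf_{\lambda I_N\le A\le\Lambda I_N}-\mathrm{Tr}(AM) \] be the Pucci extremal operators. Let $F:\mathbb R^N\times\mathrm{Sym}_N\to\mathbb R$ be continuous with $F(x,0)=0$ for all $x$, and uniformly elliptic, i.e. \[ \mathcal M^-_{\lambda,\Lambda}(M-Q)\le F(x,M)-F(x,Q)\le \mathcal M^+_{\lambda,\Lambda}(M-Q)\qquad\text{for all }x\in\mathbb R^N,\ M,Q\in\mathrm{Sym}_N,\ Q\ge 0 . \] Let $H(p)=A|p|^\gamma$, where either $A>0$ and $\gamma>0$, or $A\in\mathbb R$ and $\gamma=2$. Let $b:\mathbb R^N\to\mathbb R^N$ be locally Lipschitz (Lipschitz on every ball $\{|x|\le R\}$) and suppose that \[ b(x)\cdot x\le \lambda-\Lambda(N-1)\qquad\text{for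 all sufficiently large }|x| . \] Let $u:\mathbb R^N\to\mathbb R$ be a viscosity supersolution of $F(x,D^2u)-b(x)\cdot Du=H(Du)$ in $\mathbb R^N$, that is, $u$ is lower semicontinuous and $F(x,D^2\varphi(x))-b(x)\cdot D\varphi(x)\ge H(D\varphi(x))$ whenever $\varphi$ is $C^2$ near $x$ and $u-\varphi$ has a local minimum at $x$. If $u$ is bounded below, then $u$ is constant. -/

import Mathlib

namespace PucciLiouville

/-- The space `Sym_N` of real symmetric `N × N` matrices. -/
abbrev SymMat (N : ℕ) : Type := selfAdjoint (Matrix (Fin N) (Fin N) ℝ)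

/-- The matrices `A` with `lam I ≤ A ≤ Lam I` in the sense of quadratic forms
(such an `A` is in particular symmetric). -/
def ellipticMatrices (N : ℕ) (lam Lam : ℝ) : Set (Matrix (Fin N) (Fin N) ℝ) :=
  {A | (A - lam • (1 : Matrix (Fin N) (Fin N) ℝ)).PosSemidef ∧
    (Lam • (1 : Matrix (Fin N) (Fin N) ℝ) - A).PosSemidef}

/-- Pucci's maximal operator `M⁺(M) = sup_{lam I ≤ A ≤ Lam I} -Tr (A M)`. -/
noncomputable def pucciMax {N : ℕ} (lam Lam : ℝ) (M : SymMat N) : ℝ :=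
  sSup ((fun A : Matrix (Fin N) (Fin N) ℝ =>
    -(A * (M : Matrix (Fin N) (Fin N) ℝ)).trace) '' ellipticMatrices N lam Lam)

/-- Pucci's minimal operator `M⁻(M) = inf_{lam I ≤ A ≤ Lam I} -Tr (A M)`. -/
noncomputable def pucciMin {N : ℕ} (lam Lam : ℝ) (M : SymMat N) : ℝ :=
  sInf ((fun A : Matrix (Fin N) (Fin N) ℝ =>
    -(A * (M : Matrix (Fin N) (Fin N) ℝ)).trace) '' ellipticMatrices N lam Lam)

/-- Uniform ellipticity of `F` with constants `lam ≤ Lam`. -/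
def IsUniformlyElliptic {N : ℕ} (lam Lam : ℝ)
    (F : EuclideanSpace ℝ (Fin N) → SymMat N → ℝ) : Prop :=
  ∀ (x : EuclideanSpace ℝ (Fin N)) (M Q : SymMat N),
    (Q : Matrix (Fin N) (Fin N) ℝ).PosSemidef →
      pucciMin lam Lam (M - Q) ≤ F x M - F x Q ∧
        F x M - F x Q ≤ pucciMax lam Lam (M - Q)

/-- The Hessian matrix of `φ` at `x`, with entries `∂ᵢ∂ⱼφ(x)`. -/
noncomputable def hessianMatrix {N : ℕ} (φ : EuclideanSpace ℝ (Fin N) → ℝ)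
    (x : EuclideanSpace ℝ (Fin N)) : Matrix (Fin N) (Fin N) ℝ :=
  Matrix.of fun i j =>
    fderiv ℝ (fderiv ℝ φ) x (EuclideanSpace.single i 1) (EuclideanSpace.single j 1)

theorem hessianMatrix_mem {N : ℕ} {φ : EuclideanSpace ℝ (Fin N) → ℝ}
    {x : EuclideanSpace ℝ (Fin N)} (h : ContDiffAt ℝ 2 φ x) :
    hessianMatrix φ x ∈ selfAdjoint (Matrix (Fin N) (Fin N) ℝ) := by
  have hs : IsSymmSndFDerivAt ℝ φ x := h.isSymmSndFDerivAt (by simp)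
  rw [selfAdjoint.mem_iff]
  ext i j
  simpa [hessianMatrix, Matrix.star_apply] using
    hs (EuclideanSpace.single j 1) (EuclideanSpace.single i 1)

/-- The Hessian `D²φ(x) ∈ Sym_N` of a function that is `C²` near `x`. -/
noncomputable def hessian {N : ℕ} (φ : EuclideanSpace ℝ (Fin N) → ℝ)
    (x : EuclideanSpace ℝ (Fin N)) (h : ContDiffAt ℝ 2 φ x) : SymMat N :=
  ⟨hessianMatrix φ x, hessianMatrix_mem h⟩

/-- `u` is a viscosity supersolution of `F(x, D²u) - b(x) · Du = H(Du)` in `ℝ^N`: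
`u` is lower semicontinuous and, whenever `φ` is `C²` near `x` and `u - φ` has a local
minimum at `x`, one has `F(x, D²φ(x)) - b(x) · Dφ(x) ≥ H(Dφ(x))`. -/
def IsViscositySupersolution {N : ℕ}
    (F : EuclideanSpace ℝ (Fin N) → SymMat N → ℝ)
    (b : EuclideanSpace ℝ (Fin N) → EuclideanSpace ℝ (Fin N))
    (H : EuclideanSpace ℝ (Fin N) → ℝ)
    (u : EuclideanSpace ℝ (Fin N) → ℝ) : Prop :=
  LowerSemicontinuous u ∧
    ∀ (x : EuclideanSpace ℝ (Fin N)) (φ : EuclideanSpace ℝ (Fin N) → ℝ)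
      (hφ : ContDiffAt ℝ 2 φ x), IsLocalMin (fun y => u y - φ y) x →
        H (gradient φ x) ≤ F x (hessian φ x hφ) - inner ℝ (b x) (gradient φ x)

end PucciLiouville

namespace PucciLiouville

/-! ### Pucci bounds for matrices of radial type -/

open Filter Topology Metric
open scoped MatrixOrder

/-! In both cases `H p ≥ -B‖p‖²` with `B = |A|`, and ellipticity against `Q = 0` bounds `F` by the
maximal Pucci operator. Only these two facts are used to test `u` with decreasing radial functions
(`radial_test`). The drift condition makes `log log ‖x‖²` a Lyapunov function at infinity:
subtracting a small multiple of it gives a strict subsolution that lies below `u` on a large sphere.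
Comparison shows that the infimum of `u` over a large ball is global (`le_of_drift`). Lower
semicontinuity makes it attained, and a Hopf barrier gives the strong minimum principle
(`false_of_touching_ball`, `eq_of_forall_le`), so `u` is constant. -/

/-- The quadratic form of a positive semidefinite matrix is bounded by its trace. -/
theorem dotProduct_mulVec_le_trace_mul {N : ℕ} {P : Matrix (Fin N) (Fin N) ℝ}
    (hP : P.PosSemidef) (z : Fin N → ℝ) :
    z ⬝ᵥ P.mulVec z ≤ P.trace * (z ⬝ᵥ z) := by
  rw [← Matrix.nonneg_iff_posSemidef] at hP
  obtain ⟨B, rfl⟩ := CStarAlgebra.nonneg_iff_eq_star_mul_self.1 hP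
  rw [Matrix.star_eq_conjTranspose]
  have h1 : z ⬝ᵥ (B.conjTranspose * B).mulVec z = ∑ i, (∑ j, B i j * z j) ^ 2 := by
    rw [← Matrix.mulVec_mulVec, Matrix.dotProduct_mulVec, Matrix.conjTranspose_eq_transpose_of_trivial,
      Matrix.vecMul_transpose]
    simp [dotProduct, Matrix.mulVec, sq]
  have h2 : (B.conjTranspose * B).trace = ∑ i, ∑ j, B i j ^ 2 := by
    rw [Finset.sum_comm]
    simp [Matrix.trace, Matrix.mul_apply, sq]
  rw [h1, h2, Finset.sum_mul]
  refine Finset.sum_le_sum fun i _ => ?_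
  refine (Finset.sum_mul_sq_le_sq_mul_sq _ _ _).trans_eq ?_
  simp [dotProduct, sq]

/-- Applying the trace bound to `Lam • 1 - A` gives `tr A ≤ Lam (N - 1) + zᵀAz / |z|²`, which
accounts for the `N - 1` tangential directions. Since `p ≤ 0`, what remains is a nonnegative
multiple of `zᵀAz ≥ lam |z|²`. -/
theorem le_trace_mul_of_mem_ellipticMatrices {N : ℕ} {lam Lam : ℝ}
    {A : Matrix (Fin N) (Fin N) ℝ} (hA : A ∈ ellipticMatrices N lam Lam) {z : Fin N → ℝ}
    (hz : 0 < z ⬝ᵥ z) {p q : ℝ} (hp : p ≤ 0) (hpq : 0 ≤ p + q * (z ⬝ᵥ z)) :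
    p * Lam * (N - 1) + (p + q * (z ⬝ᵥ z)) * lam ≤
      (A * (p • (1 : Matrix (Fin N) (Fin N) ℝ) + q • Matrix.vecMulVec z z)).trace := by
  obtain ⟨h1, h2⟩ := hA
  have e1 := h1.dotProduct_mulVec_nonneg z
  have e2 := dotProduct_mulVec_le_trace_mul h2 z
  simp only [star_trivial, Matrix.sub_mulVec, Matrix.smul_mulVec, Matrix.one_mulVec,
    dotProduct_sub, dotProduct_smul, smul_eq_mul, Matrix.trace_sub, Matrix.trace_smul,
    Matrix.trace_one, Fintype.card_fin] at e1 e2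
  have e3 : (A * (p • (1 : Matrix (Fin N) (Fin N) ℝ) + q • Matrix.vecMulVec z z)).trace =
      p * A.trace + q * (z ⬝ᵥ A.mulVec z) := by
    simp [Matrix.mul_add, Matrix.mul_vecMulVec, Matrix.trace_vecMulVec, dotProduct_comm]
  rw [e3]
  set r := z ⬝ᵥ z
  set a := z ⬝ᵥ A.mulVec z
  have e4 : A.trace * r ≤ Lam * (N - 1) * r + a := by linarith
  refine le_of_mul_le_mul_right ?_ hz
  have e5 := mul_le_mul_of_nonpos_left e4 hp
  have e6 := mul_le_mul_of_nonneg_left (sub_nonneg.1 e1) hpq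
  linarith

theorem pucciMax_le {N : ℕ} {lam Lam : ℝ} (hLam : lam ≤ Lam) {z : Fin N → ℝ}
    (hz : 0 < z ⬝ᵥ z) {p q : ℝ} (hp : p ≤ 0) (hpq : 0 ≤ p + q * (z ⬝ᵥ z)) {M : SymMat N}
    (hM : (M : Matrix (Fin N) (Fin N) ℝ) =
      p • (1 : Matrix (Fin N) (Fin N) ℝ) + q • Matrix.vecMulVec z z) :
    pucciMax lam Lam M ≤ -(p * Lam * (N - 1) + (p + q * (z ⬝ᵥ z)) * lam) := by
  refine csSup_le ?_ ?_
  · refine Set.Nonempty.image _ ⟨lam • 1, ?_, ?_⟩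
    · simpa using Matrix.PosSemidef.zero
    · rw [← sub_smul]
      exact Matrix.PosSemidef.one.smul (sub_nonneg.2 hLam)
  · rintro _ ⟨A, hA, rfl⟩
    simp only [hM]
    exact neg_le_neg (le_trace_mul_of_mem_ellipticMatrices hA hz hp hpq)

/-! ### Derivatives of radial functions -/

section Radial

variable {N : ℕ} {f f₁ : ℝ → ℝ} {f₂ : ℝ} {x y : EuclideanSpace ℝ (Fin N)}

theorem hasFDerivAt_radial (hf : HasDerivAt f (f₁ (‖x - y‖ ^ 2)) (‖x - y‖ ^ 2)) :
    HasFDerivAt (fun w => f (‖w - y‖ ^ 2))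
      ((2 * f₁ (‖x - y‖ ^ 2)) • innerSL ℝ (x - y)) x := by
  have h1 : HasFDerivAt (fun w : EuclideanSpace ℝ (Fin N) => ‖w - y‖ ^ 2)
      (2 • innerSL ℝ (x - y)) x := by
    simpa using ((hasFDerivAt_id x).sub_const y).norm_sq
  refine (hf.comp_hasFDerivAt x h1).congr_fderiv ?_
  ext v
  simp
  ring

theorem gradient_radial (hf : HasDerivAt f (f₁ (‖x - y‖ ^ 2)) (‖x - y‖ ^ 2)) :
    gradient (fun w => f (‖w - y‖ ^ 2)) x = (2 * f₁ (‖x - y‖ ^ 2)) • (x - y) := by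
  refine HasGradientAt.gradient ?_
  rw [hasGradientAt_iff_hasFDerivAt]
  refine (hasFDerivAt_radial hf).congr_fderiv ?_
  ext v
  simp

theorem hessianMatrix_radial (hf : ∀ᶠ t in 𝓝 (‖x - y‖ ^ 2), HasDerivAt f (f₁ t) t)
    (hf₁ : HasDerivAt f₁ f₂ (‖x - y‖ ^ 2)) :
    hessianMatrix (fun w => f (‖w - y‖ ^ 2)) x =
      (2 * f₁ (‖x - y‖ ^ 2)) • (1 : Matrix (Fin N) (Fin N) ℝ) +
        (4 * f₂) • Matrix.vecMulVec (x - y).ofLp (x - y).ofLp := by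
  have hc : Tendsto (fun w : EuclideanSpace ℝ (Fin N) => ‖w - y‖ ^ 2) (𝓝 x)
      (𝓝 (‖x - y‖ ^ 2)) :=
    Continuous.tendsto (by fun_prop) x
  have h1 : fderiv ℝ (fun w => f (‖w - y‖ ^ 2)) =ᶠ[𝓝 x]
      fun w => (2 * f₁ (‖w - y‖ ^ 2)) • innerSL ℝ (w - y) :=
    (hc.eventually hf).mono fun w hw => (hasFDerivAt_radial hw).fderiv
  have h2 : HasFDerivAt (fun w => 2 * f₁ (‖w - y‖ ^ 2))
      (2 • (2 * f₂) • innerSL ℝ (x - y)) x := by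
    have := (hasFDerivAt_radial (f := f₁) (f₁ := fun _ => f₂) hf₁).const_mul 2
    refine this.congr_fderiv ?_
    ext v
    simp
  -- `innerSL ℝ` is conjugate-linear in its first argument; `L` is the same map typed as a linear
  -- one, so that it can be differentiated.
  obtain ⟨L, hL⟩ : ∃ L : EuclideanSpace ℝ (Fin N) →L[ℝ] EuclideanSpace ℝ (Fin N) →L[ℝ] ℝ,
      ∀ v w, L v w = inner ℝ v w := ⟨innerSL ℝ, fun _ _ => rfl⟩
  have h3 : HasFDerivAt (fun w : EuclideanSpace ℝ (Fin N) => innerSL ℝ (w - y)) L x := by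
    have h : (fun w : EuclideanSpace ℝ (Fin N) => innerSL ℝ (w - y)) = fun w => L (w - y) := by
      ext w v
      simp [hL]
    rw [h]
    exact L.hasFDerivAt.comp x ((hasFDerivAt_id x).sub_const y)
  have h4 := (h1.fderiv_eq (𝕜 := ℝ)).trans (h2.smul h3).fderiv
  ext i j
  rw [hessianMatrix, Matrix.of_apply, h4]
  simp [hL, Matrix.vecMulVec_apply, Matrix.one_apply, EuclideanSpace.inner_single_right]
  split_ifs <;> simp_all <;> ring

end Radial

/-! ### Comparison at infinity and strong minimum principle -/

section Supersolution

variable {N : ℕ} {lam Lam B : ℝ} {F : EuclideanSpace ℝ (Fin N) → SymMat N → ℝ}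
  {b : EuclideanSpace ℝ (Fin N) → EuclideanSpace ℝ (Fin N)} {H u : EuclideanSpace ℝ (Fin N) → ℝ}

/-- The supersolution inequality at a point where a radially decreasing function, whose
Hessian is nonnegative in the radial direction, touches from below. -/
theorem IsViscositySupersolution.radial_test (hu : IsViscositySupersolution F b H u)
    (hLam : lam ≤ Lam) (hFell : IsUniformlyElliptic lam Lam F) (hF0 : ∀ x, F x 0 = 0)
    (hH : ∀ p, -(B * ‖p‖ ^ 2) ≤ H p) {f f₁ : ℝ → ℝ} {s p q : ℝ} {x y : EuclideanSpace ℝ (Fin N)}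
    (hs : ‖x - y‖ ^ 2 = s) (hs0 : 0 < s) (hfc : ContDiffAt ℝ 2 f s)
    (hf : ∀ᶠ t in 𝓝 s, HasDerivAt f (f₁ t) t) (hp : f₁ s = p) (hq : HasDerivAt f₁ q s)
    (hp0 : p ≤ 0) (hpq : 0 ≤ p + 2 * q * s)
    (hmin : IsLocalMin (fun w => u w - f (‖w - y‖ ^ 2)) x) :
    -(4 * B * p ^ 2 * s) ≤ -(2 * p * Lam * (N - 1) + (2 * p + 4 * q * s) * lam) -
      2 * p * inner ℝ (b x) (x - y) := by
  subst hs hp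
  have hφ : ContDiffAt ℝ 2 (fun w : EuclideanSpace ℝ (Fin N) => f (‖w - y‖ ^ 2)) x :=
    hfc.comp x (ContDiff.contDiffAt ((contDiff_id.sub contDiff_const).norm_sq ℝ))
  have key := hu.2 x _ hφ hmin
  rw [gradient_radial hf.self_of_nhds] at key
  have hz : (x - y).ofLp ⬝ᵥ (x - y).ofLp = ‖x - y‖ ^ 2 := by
    rw [EuclideanSpace.real_norm_sq_eq]
    simp [dotProduct, sq]
  have e1 : F x (hessian _ x hφ) ≤ pucciMax lam Lam (hessian _ x hφ) := by
    have := (hFell x (hessian _ x hφ) 0 Matrix.PosSemidef.zero).2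
    simpa [hF0] using this
  have e2 := pucciMax_le (lam := lam) hLam (z := (x - y).ofLp) (by rwa [hz])
    (p := 2 * f₁ (‖x - y‖ ^ 2)) (q := 4 * q) (by linarith) (by rw [hz]; linarith)
    (M := hessian _ x hφ) (hessianMatrix_radial hf hq)
  rw [hz] at e2
  have e3 := hH ((2 * f₁ (‖x - y‖ ^ 2)) • (x - y))
  rw [norm_smul, mul_pow, Real.norm_eq_abs, sq_abs] at e3
  rw [inner_smul_right] at key
  linarith

/-- Outside a large ball, a supersolution bounded below is controlled by its values on the ball. -/
theorem IsViscositySupersolution.le_of_drift (hu : IsViscositySupersolution F b H u)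
    (hlam : 0 < lam) (hLam : lam ≤ Lam) (hFell : IsUniformlyElliptic lam Lam F)
    (hF0 : ∀ x, F x 0 = 0) (hH : ∀ p, -(B * ‖p‖ ^ 2) ≤ H p) {R : ℝ} (hR : 2 ≤ R)
    (hb : ∀ x : EuclideanSpace ℝ (Fin N), R ≤ ‖x‖ → inner ℝ (b x) x ≤ lam - Lam * ((N : ℝ) - 1))
    (hubdd : BddBelow (Set.range u)) {m : ℝ} (hm : ∀ x, ‖x‖ ≤ R → m ≤ u x)
    (x : EuclideanSpace ℝ (Fin N)) : m ≤ u x := by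
  obtain ⟨l, hl⟩ := hubdd
  replace hl : ∀ x, l ≤ u x := fun x => hl ⟨x, rfl⟩
  rcases le_or_gt ‖x‖ R with hx | hx
  · exact hm x hx
  have hlog : ∀ t, R ^ 2 ≤ t → 0 < Real.log t := fun t ht => Real.log_pos (by nlinarith)
  have hlogR := hlog _ le_rfl
  -- A single logarithm would make the drift inequality only borderline. The second one leaves the
  -- term `-4 ε lam / (t log² t)`, of the same order in `t` as the quadratic gradient term `-4 B ε²
  -- / (t log² t)`, so `B ε < lam` decides.
  let g : ℝ → ℝ := fun t => Real.log (Real.log t) - Real.log (Real.log (R ^ 2))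
  have hg1 : ∀ t, 1 < t → HasDerivAt g (1 / (t * Real.log t)) t := by
    intro t ht
    have h := ((Real.hasDerivAt_log (by linarith : t ≠ 0)).log (Real.log_pos ht).ne').sub_const
      (Real.log (Real.log (R ^ 2)))
    refine h.congr_deriv ?_
    have := Real.log_pos ht
    field_simp
  have hg2 : ∀ t, 1 < t → HasDerivAt (fun t => 1 / (t * Real.log t))
      (-(Real.log t + 1) / (t * Real.log t) ^ 2) t := by
    intro t ht
    have hl := Real.log_pos ht
    have h := ((hasDerivAt_id t).mul (Real.hasDerivAt_log (by linarith : t ≠ 0))).inv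
      (mul_pos (by linarith : 0 < t) hl).ne'
    simp only [one_div]
    refine h.congr_deriv ?_
    simp [show t ≠ 0 by linarith]
  have hgt : Tendsto g atTop atTop :=
    tendsto_atTop_add_const_right _ _ (Real.tendsto_log_atTop.comp Real.tendsto_log_atTop)
  have main : ∀ ε, 0 < ε → B * ε < lam → m - ε * g (‖x‖ ^ 2) ≤ u x := by
    intro ε hε hBε
    by_contra! hlt
    obtain ⟨T, hT⟩ := (hgt.eventually_ge_atTop ((m - l) / ε)).exists_forall_of_atTop
    -- `T` puts the barrier below `l` on the outer sphere, `1` gives `R' ≤ R' ^ 2`, and `‖x‖` keeps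
    -- `x` in the annulus.
    let R' := max (max T 1) ‖x‖
    have hR'1 : 1 ≤ R' := (le_max_right _ _).trans (le_max_left _ _)
    have hR'T : T ≤ R' ^ 2 := by
      have : T ≤ R' := (le_max_left _ _).trans (le_max_left _ _)
      nlinarith
    let f : ℝ → ℝ := fun t => m - ε * g t
    let K : Set (EuclideanSpace ℝ (Fin N)) := {w | R ≤ ‖w‖} ∩ closedBall 0 R'
    have hK : IsCompact K := (isCompact_closedBall _ _).inter_left
      (isClosed_le continuous_const continuous_norm)
    have hxK : x ∈ K := ⟨hx.le, by simp [R']⟩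
    have hsq : ∀ w : EuclideanSpace ℝ (Fin N), R ≤ ‖w‖ → R ^ 2 ≤ ‖w‖ ^ 2 := fun w hw => by
      gcongr
    have hone : ∀ w : EuclideanSpace ℝ (Fin N), R ≤ ‖w‖ → 1 < ‖w‖ ^ 2 := fun w hw => by
      nlinarith
    have hlsc : LowerSemicontinuousOn (fun w => u w - f (‖w - 0‖ ^ 2)) K := by
      have hc : ContinuousOn (fun w : EuclideanSpace ℝ (Fin N) => -f (‖w - 0‖ ^ 2)) K := by
        refine ContinuousOn.neg (continuousOn_const.sub (continuousOn_const.mul ?_))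
        intro w hw
        simp only [sub_zero]
        exact ((hg1 _ (hone w hw.1)).continuousAt.comp (f := fun w => ‖w‖ ^ 2)
          (by fun_prop : Continuous fun w : EuclideanSpace ℝ (Fin N) =>
            ‖w‖ ^ 2).continuousAt).continuousWithinAt
      simpa only [sub_eq_add_neg] using
        (hu.1.lowerSemicontinuousOn K).add hc.lowerSemicontinuousOn
    obtain ⟨z, hzK, hz⟩ := hlsc.exists_isMinOn ⟨x, hxK⟩ hK
    have hzlt : u z < f (‖z‖ ^ 2) := by
      have h := hz hxK
      simp only [Set.mem_ofPred_eq, sub_zero] at h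
      change u x < f (‖x‖ ^ 2) at hlt
      linarith
    -- On the inner sphere `g` vanishes, so the barrier equals `m ≤ u` there.
    have hzR : R < ‖z‖ := by
      refine lt_of_le_of_ne hzK.1 fun h => ?_
      have := hm z h.ge
      simp only [f, g, ← h, sub_self, mul_zero, sub_zero] at hzlt
      linarith
    have hzR' : ‖z‖ < R' := by
      refine lt_of_le_of_ne (by simpa using hzK.2) fun h => ?_
      have h1 := hT (‖z‖ ^ 2) (by rwa [h])
      rw [div_le_iff₀ hε] at h1
      have h2 := hl z
      simp only [f] at hzlt
      linarith
    have hmin : IsLocalMin (fun w => u w - f (‖w - 0‖ ^ 2)) z := by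
      refine hz.isLocalMin ?_
      filter_upwards [continuous_norm.continuousAt.eventually_mem (Ioo_mem_nhds hzR hzR')] with w hw
      exact ⟨hw.1.le, by simpa using hw.2.le⟩
    have ht1 := hone z hzR.le
    set t := ‖z‖ ^ 2 with ht
    have hL := hlog t (hsq z hzR.le)
    have ht0 : 0 < t := by linarith
    have hfc : ContDiffAt ℝ 2 f t := by
      refine contDiffAt_const.sub (contDiffAt_const.mul (ContDiffAt.sub ?_ contDiffAt_const))
      exact (contDiffAt_id.log (by simpa using ht0.ne')).log (by simpa using hL.ne')
    have key := hu.radial_test (x := z) (y := 0) hLam hFell hF0 hH (f := f)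
      (f₁ := fun t => -(ε * (1 / (t * Real.log t)))) (s := t)
      (p := -(ε * (1 / (t * Real.log t))))
      (q := -(ε * (-(Real.log t + 1) / (t * Real.log t) ^ 2)))
      (by rw [sub_zero]) ht0 hfc
      ((lt_mem_nhds ht1).mono fun r hr => ((hg1 r hr).const_mul ε).const_sub m) rfl
      ((hg2 t ht1).const_mul ε).neg
      (neg_nonpos.2 (by positivity))
      (by
        have : -(ε * (1 / (t * Real.log t))) +
          2 * -(ε * (-(Real.log t + 1) / (t * Real.log t) ^ 2)) * t =
            ε * (Real.log t + 2) / (t * Real.log t ^ 2) := by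
          field_simp
          ring
        rw [this]
        positivity) hmin
    rw [sub_zero] at key
    have hbz := hb z hzR.le
    set L := Real.log t
    set i := inner ℝ (b z) z
    have e1 : -(4 * B * (-(ε * (1 / (t * L)))) ^ 2 * t) = -(4 * B * ε ^ 2) / (t * L ^ 2) := by
      field_simp
    have e2 : -(2 * (-(ε * (1 / (t * L)))) * Lam * (N - 1) +
        (2 * (-(ε * (1 / (t * L)))) + 4 * -(ε * (-(L + 1) / (t * L) ^ 2)) * t) * lam) -
        2 * (-(ε * (1 / (t * L)))) * i =
        (2 * ε * L * (Lam * (N - 1) + i - lam) - 4 * ε * lam) / (t * L ^ 2) := by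
      field_simp
      ring
    rw [e1, e2, div_le_div_iff_of_pos_right (by positivity)] at key
    have e3 : 0 ≤ 2 * ε * L * (lam - Lam * (N - 1) - i) :=
      mul_nonneg (by positivity) (by linarith)
    have e4 := mul_lt_mul_of_pos_left hBε hε
    nlinarith
  have hlim : Tendsto (fun ε => m - ε * g (‖x‖ ^ 2)) (𝓝[>] 0) (𝓝 m) := by
    have : Tendsto (fun ε => m - ε * g (‖x‖ ^ 2)) (𝓝 0) (𝓝 (m - 0 * g (‖x‖ ^ 2))) :=
      Continuous.tendsto (by fun_prop) 0
    simpa using this.mono_left nhdsWithin_le_nhds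
  refine le_of_tendsto hlim ?_
  have hsm : ∀ᶠ ε in 𝓝 (0 : ℝ), B * ε < lam :=
    (Continuous.tendsto (by fun_prop : Continuous fun ε => B * ε) 0).eventually_lt_const
      (by simpa using hlam)
  filter_upwards [self_mem_nhdsWithin, hsm.filter_mono nhdsWithin_le_nhds] with ε h1 h2
  exact main ε h1 h2

/-- A supersolution cannot attain its minimum at the boundary of an interior ball on which the
minimum is not attained. -/
theorem IsViscositySupersolution.false_of_touching_ball (hu : IsViscositySupersolution F b H u)
    (hlam : 0 < lam) (hLam : lam ≤ Lam) (hFell : IsUniformlyElliptic lam Lam F)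
    (hF0 : ∀ x, F x 0 = 0) (hB : 0 ≤ B) (hH : ∀ p, -(B * ‖p‖ ^ 2) ≤ H p)
    {y z : EuclideanSpace ℝ (Fin N)} {ρ C : ℝ} (hρ : 0 < ρ) (hyz : ‖z - y‖ = ρ)
    (hC : ∀ x ∈ closedBall z (ρ / 2), ‖b x‖ ≤ C) (hmin : ∀ x, u z ≤ u x)
    (hlt : ∀ x ∈ closedBall y ρ, x ≠ z → u z < u x) : False := by
  have hC0 : 0 ≤ C := (norm_nonneg _).trans (hC z (mem_closedBall_self (by positivity)))
  -- This part of the sphere is compact and misses `z`, so `u` exceeds its minimum there by a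
  -- uniform gap.
  obtain ⟨δ, hδ, hδu⟩ : ∃ δ > 0, ∀ x ∈ sphere z (ρ / 2) ∩ closedBall y ρ, u z + δ ≤ u x := by
    rcases (sphere z (ρ / 2) ∩ closedBall y ρ).eq_empty_or_nonempty with h | h
    · exact ⟨1, one_pos, by simp [h]⟩
    · obtain ⟨w, hw, hwm⟩ := (hu.1.lowerSemicontinuousOn _).exists_isMinOn h
        ((isCompact_sphere _ _).inter_right isClosed_closedBall)
      have hwz : w ≠ z := by
        rintro rfl
        have := hw.1
        simp at this
        linarith
      exact ⟨u w - u z, sub_pos.2 (hlt w hw.2 hwz), fun x hx => by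
        have h : u w ≤ u x := hwm hx
        linarith⟩
  -- All terms that `α lam s` must beat for `s ≥ ρ² / 4`; the `1` makes the final contradiction
  -- strict.
  let D := |Lam * (N - 1)| + lam + C * (2 * ρ) + 1
  have hD : 0 < D := by positivity
  obtain ⟨α, hα, hαD⟩ : ∃ α > 0, α * lam * (ρ ^ 2 / 4) = D :=
    ⟨D / (lam * (ρ ^ 2 / 4)), by positivity, by field_simp⟩
  -- `ε < δ` keeps the perturbation below the gap; `2 B ε ≤ lam` lets the gradient term absorb at
  -- most half of `2 α s lam`.
  obtain ⟨ε, hε, hεδ, hεB⟩ : ∃ ε > 0, ε < δ ∧ 2 * B * ε ≤ lam := by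
    have h : ∀ᶠ ε in 𝓝[>] (0 : ℝ), 0 < ε ∧ ε < δ ∧ 2 * B * ε < lam := by
      refine eventually_mem_nhdsWithin.and (Eventually.filter_mono nhdsWithin_le_nhds ?_)
      exact (gt_mem_nhds hδ).and
        ((Continuous.tendsto (by fun_prop : Continuous fun ε => 2 * B * ε) 0).eventually_lt_const
          (by simpa using hlam))
    obtain ⟨ε, h1, h2, h3⟩ := h.exists
    exact ⟨ε, h1, h2, h3.le⟩
  let f : ℝ → ℝ := fun t => ε * Real.exp (-α * t)
  have hf : ∀ t, HasDerivAt f (-(α * ε * Real.exp (-α * t))) t := fun t => by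
    refine ((((hasDerivAt_id t).const_mul (-α)).exp).const_mul ε).congr_deriv ?_
    simp
    ring
  have hf₁ : ∀ t, HasDerivAt (fun t => -(α * ε * Real.exp (-α * t)))
      (α ^ 2 * ε * Real.exp (-α * t)) t := fun t => by
    refine ((((hasDerivAt_id t).const_mul (-α)).exp).const_mul (α * ε)).neg.congr_deriv ?_
    simp
    ring
  have hfpos : ∀ t, 0 < f t := fun t => by positivity
  have hfle : ∀ t, 0 ≤ t → f t ≤ ε := fun t ht => by
    have : Real.exp (-α * t) ≤ 1 := Real.exp_le_one_iff.2 (by nlinarith)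
    nlinarith
  have hlsc : LowerSemicontinuousOn (fun w => u w - f (‖w - y‖ ^ 2)) (closedBall z (ρ / 2)) := by
    have hc : Continuous (fun w : EuclideanSpace ℝ (Fin N) => -f (‖w - y‖ ^ 2)) := by
      simp only [f]
      fun_prop
    simpa only [sub_eq_add_neg] using
      (hu.1.add hc.lowerSemicontinuous).lowerSemicontinuousOn _
  have hzmem : z ∈ closedBall z (ρ / 2) := mem_closedBall_self (by positivity)
  obtain ⟨x, hxK, hx⟩ := hlsc.exists_isMinOn ⟨z, hzmem⟩ (isCompact_closedBall _ _)
  have hxz : u x - f (‖x - y‖ ^ 2) ≤ u z - f (‖z - y‖ ^ 2) := hx hzmem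
  -- On the small sphere, the gap `δ` excludes points inside the ball about `y`; outside it the bump
  -- is smaller than at `z`, where `u` is already minimal.
  have hxb : x ∈ ball z (ρ / 2) := by
    by_contra hxb
    have hxs : x ∈ sphere z (ρ / 2) :=
      le_antisymm (mem_closedBall.1 hxK) (not_lt.1 hxb)
    by_cases hxy : x ∈ closedBall y ρ
    · have h1 := hδu x ⟨hxs, hxy⟩
      have h2 := hfle (‖x - y‖ ^ 2) (by positivity)
      have h3 := hfpos (‖z - y‖ ^ 2)
      linarith
    · rw [mem_closedBall, dist_eq_norm, not_le, ← hyz] at hxy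
      have h1 : f (‖x - y‖ ^ 2) < f (‖z - y‖ ^ 2) := by
        refine mul_lt_mul_of_pos_left (Real.exp_lt_exp.2 ?_) hε
        have : ‖z - y‖ ^ 2 < ‖x - y‖ ^ 2 := by gcongr
        nlinarith
      linarith [hmin x]
  have hloc : IsLocalMin (fun w => u w - f (‖w - y‖ ^ 2)) x :=
    hx.isLocalMin (mem_of_superset (isOpen_ball.mem_nhds hxb) ball_subset_closedBall)
  have hxzn : ‖x - z‖ ≤ ρ / 2 := by rw [← dist_eq_norm]; exact hxK
  have hn1 : ρ / 2 ≤ ‖x - y‖ := by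
    have := norm_sub_norm_le (z - y) (z - x)
    rw [sub_sub_sub_cancel_left, norm_sub_rev z x, hyz] at this
    linarith
  have hn2 : ‖x - y‖ ≤ 2 * ρ := by
    have := norm_sub_le_norm_sub_add_norm_sub x z y
    linarith
  have hs1 : ρ ^ 2 / 4 ≤ ‖x - y‖ ^ 2 := by nlinarith
  have hin : -(C * (2 * ρ)) ≤ -inner ℝ (b x) (x - y) := by
    have h1 := (real_inner_le_norm (b x) (x - y)).trans
      (mul_le_mul (hC x hxK) hn2 (norm_nonneg _) hC0)
    linarith
  have hin' : inner ℝ (b x) (x - y) ≤ C * (2 * ρ) := by linarith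
  generalize hs : ‖x - y‖ ^ 2 = s at hs1
  have hs0 : 0 < s := by nlinarith [sq_pos_of_pos hρ]
  have hαs : D ≤ α * lam * s := hαD ▸ mul_le_mul_of_nonneg_left hs1 (by positivity)
  have hαs1 : 1 ≤ α * s := by
    have : lam ≤ D := by
      have := abs_nonneg (Lam * ((N : ℝ) - 1))
      have : 0 ≤ C * (2 * ρ) := by positivity
      simp only [D]
      linarith
    nlinarith
  have hE1 : Real.exp (-α * s) ≤ 1 := Real.exp_le_one_iff.2 (by nlinarith)
  have hE0 := Real.exp_pos (-α * s)
  have key := hu.radial_test (x := x) (y := y) hLam hFell hF0 hH hs hs0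
    (contDiff_const.mul (Real.contDiff_exp.comp (contDiff_const.mul contDiff_id))).contDiffAt
    (Eventually.of_forall hf) rfl (hf₁ s) (neg_nonpos.2 (by positivity))
    (by
      have h : 0 ≤ α * ε * Real.exp (-α * s) * (2 * (α * s) - 1) :=
        mul_nonneg (by positivity) (by linarith)
      linarith) hloc
  set E := Real.exp (-α * s)
  set i := inner ℝ (b x) (x - y)
  have hk : 0 < 2 * α * ε * E := by positivity
  have key' : -(2 * B * ε * E * (α * s)) ≤
      Lam * (N - 1) - (2 * (α * s) - 1) * lam + i := by
    refine le_of_mul_le_mul_left ?_ hk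
    linarith
  have h1 : 2 * B * ε * E * (α * s) ≤ lam * (α * s) := by
    refine mul_le_mul_of_nonneg_right ?_ (by positivity)
    calc 2 * B * ε * E ≤ 2 * B * ε * 1 := mul_le_mul_of_nonneg_left hE1 (by positivity)
      _ ≤ lam := by linarith
  have h2 := le_abs_self (Lam * ((N : ℝ) - 1))
  simp only [D] at hαs
  linarith

/-- The strong minimum principle. -/
theorem IsViscositySupersolution.eq_of_forall_le (hu : IsViscositySupersolution F b H u)
    (hlam : 0 < lam) (hLam : lam ≤ Lam) (hFell : IsUniformlyElliptic lam Lam F)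
    (hF0 : ∀ x, F x 0 = 0) (hB : 0 ≤ B) (hH : ∀ p, -(B * ‖p‖ ^ 2) ≤ H p) (hb : Continuous b)
    {z₀ : EuclideanSpace ℝ (Fin N)} (hmin : ∀ x, u z₀ ≤ u x) (x : EuclideanSpace ℝ (Fin N)) :
    u x = u z₀ := by
  by_contra hne
  have hcl : IsClosed (u ⁻¹' Set.Iic (u z₀)) := hu.1.isClosed_preimage _
  obtain ⟨z, hz, hzd⟩ := hcl.exists_infDist_eq_dist ⟨z₀, le_refl (u z₀)⟩ x
  have hzm : u z = u z₀ := le_antisymm hz (hmin z)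
  have hfar : ∀ w, u w ≤ u z₀ → dist x z ≤ dist x w := fun w hw =>
    hzd ▸ infDist_le_dist_of_mem hw
  -- The ball about the midpoint `y` with radius `‖d‖` lies in the ball about `x` through `z` and
  -- meets its sphere only at `z`, so the nearest minimum point `z` is its only minimum point.
  set d := (1 / 2 : ℝ) • (x - z) with hd
  set y := z + d with hy
  have hx : x = y + d := by
    rw [hy, hd]
    module
  have hzy : z - y = -d := by
    rw [hy]
    abel
  have hd0 : d ≠ 0 := by
    intro h
    rw [hx, hy, h, add_zero, add_zero] at hne
    exact hne hzm
  obtain ⟨C, hC⟩ := (isCompact_closedBall z (‖d‖ / 2)).exists_bound_of_continuousOn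
    hb.continuousOn
  refine hu.false_of_touching_ball hlam hLam hFell hF0 hB hH (y := y) (z := z) (norm_pos_iff.2 hd0)
    (by rw [hzy, norm_neg]) hC (fun w => hzm ▸ hmin w) fun w hw hwz => ?_
  by_contra! hle
  refine hwz (sub_eq_zero.1 (norm_eq_zero.1 (sq_eq_zero_iff.1 (le_antisymm ?_ (sq_nonneg _)))))
  have h1 := hfar w (hle.trans_eq hzm)
  have h2 : dist x z = 2 * ‖d‖ := by
    rw [dist_eq_norm, hd, norm_smul]
    norm_num
    ring
  have h3 : dist x w = ‖(w - y) - d‖ := by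
    rw [dist_eq_norm, norm_sub_rev, hx]
    congr 1
    abel
  have h4 : w - z = (w - y) + d := by
    rw [hy]
    abel
  rw [mem_closedBall, dist_eq_norm] at hw
  rw [h2, h3] at h1
  have h5 := pow_le_pow_left₀ (by positivity) h1 2
  have h6 := pow_le_pow_left₀ (norm_nonneg _) hw 2
  rw [norm_sub_sq_real] at h5
  rw [h4, norm_add_sq_real]
  linarith

end Supersolution

end PucciLiouville

/-! ### The Liouville theorem -/

theorem mainTheorem3 (N : ℕ) (lam Lam : ℝ) (hlam : 0 < lam) (hLam : lam ≤ Lam)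
    (F : EuclideanSpace ℝ (Fin N) → PucciLiouville.SymMat N → ℝ)
    (hFcont : Continuous
      (fun p : EuclideanSpace ℝ (Fin N) × PucciLiouville.SymMat N => F p.1 p.2))
    (hFell : PucciLiouville.IsUniformlyElliptic lam Lam F)
    (hF0 : ∀ x, F x 0 = 0)
    (A γ : ℝ) (hAγ : (0 < A ∧ 0 < γ) ∨ γ = 2)
    (b : EuclideanSpace ℝ (Fin N) → EuclideanSpace ℝ (Fin N))
    (hbLip : ∀ R : ℝ, 0 < R → ∃ K : NNReal, LipschitzOnWith K b (Metric.closedBall 0 R))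
    (hbdrift : ∃ R₀ : ℝ, ∀ x : EuclideanSpace ℝ (Fin N), R₀ ≤ ‖x‖ →
      inner ℝ (b x) x ≤ lam - Lam * ((N : ℝ) - 1))
    (u : EuclideanSpace ℝ (Fin N) → ℝ)
    (hu : PucciLiouville.IsViscositySupersolution F b (fun p => A * ‖p‖ ^ γ) u)
    (hubdd : BddBelow (Set.range u)) :
    ∃ c : ℝ, ∀ x, u x = c := by
  have hH : ∀ p : EuclideanSpace ℝ (Fin N), -(|A| * ‖p‖ ^ 2) ≤ A * ‖p‖ ^ γ := by
    intro p
    rcases hAγ with ⟨hA, -⟩ | rfl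
    · have h1 : 0 ≤ A * ‖p‖ ^ γ := by positivity
      have h2 : 0 ≤ |A| * ‖p‖ ^ 2 := by positivity
      linarith
    · rw [Real.rpow_two, ← neg_mul]
      exact mul_le_mul_of_nonneg_right (neg_abs_le A) (sq_nonneg _)
  have hb : Continuous b := continuous_iff_continuousAt.2 fun x => by
    obtain ⟨K, hK⟩ := hbLip (‖x‖ + 1) (by positivity)
    exact hK.continuousOn.continuousAt
      (Filter.mem_of_superset (Metric.isOpen_ball.mem_nhds (by simp)) Metric.ball_subset_closedBall)
  obtain ⟨R₀, hR₀⟩ := hbdrift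
  obtain ⟨z, -, hz⟩ := (hu.1.lowerSemicontinuousOn _).exists_isMinOn
    ⟨0, Metric.mem_closedBall_self (x := (0 : EuclideanSpace ℝ (Fin N))) (by positivity)⟩
    (isCompact_closedBall 0 (max 2 R₀))
  exact ⟨u z, hu.eq_of_forall_le hlam hLam hFell hF0 (abs_nonneg A) hH hb
    (hu.le_of_drift hlam hLam hFell hF0 hH (le_max_left 2 R₀)
      (fun x hx => hR₀ x ((le_max_right _ _).trans hx)) hubdd
      fun x hx => hz (mem_closedBall_zero_iff.2 hx))⟩
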